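/- Let $(R,\mathfrak m)$ be a commutative Noetherian local ring of prime characteristic $p>0$ that is Cohen--Macaulay (i.e. $\operatorname{depth} R=\dim R$) and of positive dimension. For $t\ge 0$ let $\mathfrak m^{[p^t]}$ denote the ideal generated by the elements $a^{p^t}$ with $a\in\mathfrak m$, and put \[\kappa(R)=\inf\{\,t\ge 0 : \text{there is a system of parameters } \mathbf x \text{ of } R \text{ with } \mathfrak m^{[p^t]}\subseteq(\mathbf x)\,\}.\] For $n\ge 0$ and an $R$-module $M$, let $F^n(M)=M\otimes_R{}^{f^n}\!R$ be the base change of $M$ along the iterated Frobenius $f^n\colon R\to R$, $a\mapsto a^{p^n}$, regarded as an $R$-module by ordinary multiplication on the right-hand factor. Let $M$ be a finitely generated $R$-module that has a rank, i.e. $S^{-1}M$ is a free $S^{-1}R$-module of finite rank, where $S$ is the set of nonzerodivisors of $R$. Suppose that for one integer $n\ge\kappa(R)$ the module $F^n(M)$ is maximal Cohen--Macaulay, i.e. a nonzero finitely generated module with $\operatorname{depth}F^n(M)=\dim F^n(M)=\dim R$. Then $M$ is a free $R$-module. -/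

import Mathlib

open scoped TensorProduct

noncomputable section

universe u v

/-! ### Depth, Cohen-Macaulay modules and rings, systems of parameters, rank -/

/-- The depth of a module `M` over a local ring `R`: the supremum of the lengths of the
`M`-regular sequences contained in the maximal ideal. -/
def localDepth (R : Type u) [CommRing R] [IsLocalRing R] (M : Type v) [AddCommGroup M]
    [Module R M] : ℕ∞ :=
  ⨆ (xs : List R) (_ : (∀ x ∈ xs, x ∈ IsLocalRing.maximalIdeal R) ∧
    RingTheory.Sequence.IsRegular M xs), (xs.length : ℕ∞)

/-- A Cohen-Macaulay module over a (Noetherian) local ring: a finitely generated nonzero module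
whose depth equals the dimension of its support. The zero module is excluded automatically,
its support having dimension `⊥`. -/
structure IsCohenMacaulayModule (R : Type u) [CommRing R] [IsLocalRing R] (M : Type v)
    [AddCommGroup M] [Module R M] : Prop where
  finite : Module.Finite R M
  depth_eq : (localDepth R M : WithBot ℕ∞) = Module.supportDim R M

/-- A maximal Cohen-Macaulay (MCM) module: a Cohen-Macaulay module `M` with
`dim M = dim R`. -/
structure IsMaximalCohenMacaulay (R : Type u) [CommRing R] [IsLocalRing R] (M : Type v)
    [AddCommGroup M] [Module R M] : Prop extends IsCohenMacaulayModule R M where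
  dim_eq : Module.supportDim R M = ringKrullDim R

/-- A Cohen-Macaulay local ring: a Noetherian local ring that is Cohen-Macaulay as a module
over itself. -/
structure IsCohenMacaulayLocalRing (R : Type u) [CommRing R] [IsLocalRing R] : Prop where
  noetherian : IsNoetherianRing R
  cohenMacaulay : IsCohenMacaulayModule R R

/-- A (full) system of parameters of a local ring: a sequence of `dim R` elements that
generates an ideal whose radical is the maximal ideal. -/
structure IsSystemOfParameters (R : Type u) [CommRing R] [IsLocalRing R] (xs : List R) :
    Prop where
  length_eq : ((xs.length : ℕ∞) : WithBot ℕ∞) = ringKrullDim R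
  radical_eq : (Ideal.ofList xs).radical = IsLocalRing.maximalIdeal R

/-- `M` has a rank: its localization at the set of all nonzerodivisors of `R` is a free module
of some finite rank over the total ring of fractions of `R`. -/
def ModuleHasRank (R : Type u) [CommRing R] (M : Type v) [AddCommGroup M] [Module R M] : Prop :=
  ∃ r : ℕ, Nonempty (LocalizedModule (nonZeroDivisors R) M
    ≃ₗ[Localization (nonZeroDivisors R)] (Fin r → Localization (nonZeroDivisors R)))

/-! ### The Frobenius functor -/

section Frobenius

variable (R : Type u) [CommRing R] (p : ℕ) [Fact p.Prime] [CharP R p] (n : ℕ)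

/-- The Frobenius power `I^{[p^t]}` of an ideal: the ideal generated by the `p^t`-th powers of
the elements (equivalently, of any set of generators) of `I`. -/
def Ideal.frobPower {R : Type u} [CommRing R] (p t : ℕ) (I : Ideal R) : Ideal R :=
  Ideal.span ((fun x => x ^ p ^ t) '' (I : Set R))

/-- The invariant `κ(R)`: the least `t` such that `𝔪^{[p^t]}` is contained in the ideal
generated by some system of parameters. -/
def frobKappa [IsLocalRing R] (p : ℕ) : ℕ∞ :=
  ⨅ (t : ℕ) (_ : ∃ xs : List R, IsSystemOfParameters R xs ∧
    Ideal.frobPower p t (IsLocalRing.maximalIdeal R) ≤ Ideal.ofList xs), (t : ℕ∞)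

/-- The ring `R` regarded as an `R`-algebra through the iterated Frobenius
`f^n : R → R`, `a ↦ a ^ p ^ n`. -/
def FrobTwist (R : Type u) (_p _n : ℕ) : Type u := R

instance : CommRing (FrobTwist R p n) := inferInstanceAs (CommRing R)

instance : Algebra R (FrobTwist R p n) := (iterateFrobenius R p n).toAlgebra

/-- The identity map from `R` to `FrobTwist R p n`, as a ring isomorphism. -/
def FrobTwist.of : R ≃+* FrobTwist R p n := RingEquiv.refl R

theorem FrobTwist.algebraMap_apply (a : R) :
    algebraMap R (FrobTwist R p n) a = FrobTwist.of R p n (a ^ p ^ n) := rfl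

variable (M : Type v) [AddCommGroup M] [Module R M]

/-- The Frobenius functor `F^n(M)`: the base change of `M` along `f^n : R → R`. -/
def FrobFunctor : Type (max u v) := FrobTwist R p n ⊗[R] M

instance : AddCommGroup (FrobFunctor R p n M) :=
  inferInstanceAs (AddCommGroup (FrobTwist R p n ⊗[R] M))

instance : Module (FrobTwist R p n) (FrobFunctor R p n M) :=
  inferInstanceAs (Module (FrobTwist R p n) (FrobTwist R p n ⊗[R] M))

/-- `R` acts on `F^n(M)` by usual multiplication on the factor `FrobTwist R p n`. -/
instance : Module R (FrobFunctor R p n M) :=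
  Module.compHom _ (FrobTwist.of R p n : R →+* FrobTwist R p n)

theorem FrobFunctor.smul_tmul (a b : R) (m : M) :
    a • (show FrobFunctor R p n M from FrobTwist.of R p n b ⊗ₜ[R] m) =
      (show FrobFunctor R p n M from FrobTwist.of R p n (a * b) ⊗ₜ[R] m) := rfl

end Frobenius

end

/-! Take a minimal generating family g₁, …, g_k of M, so that its relations have coefficients in 𝔪.
Relations among the 1 ⊗ gᵢ come from p^n-th powers of these, so the kernel K of R^k → F^n(M) lies in
𝔪^{[p^n]}R^k ⊆ (𝐱)R^k for a suitable system of parameters 𝐱. Since 𝐱 is regular on the maximal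
Cohen–Macaulay module F^n(M), Tor₁(R/(𝐱), F^n(M)) = 0, hence K = K ∩ (𝐱)R^k = (𝐱)K, and K = 0 by
Nakayama. Thus the 1 ⊗ gᵢ form a basis, and any relation ∑ aᵢgᵢ = 0 gives aᵢ^{p^n} = 0. Rank now
removes the nilpotents: over the total ring of fractions M becomes projective, the relation module
is a direct summand with nilpotent coefficients, and Nakayama kills it. -/

/-! ### Depth, associated primes and systems of parameters. -/

open RingTheory.Sequence IsLocalRing in
/-- Passing to the quotient by a regular element of the maximal ideal lowers the available length
of regular sequences by at most one. -/
theorem exists_isRegular_quotSMulTop {R : Type u} [CommRing R] [IsLocalRing R]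
    [IsNoetherianRing R] {N : Type v} [Small.{v} R] [AddCommGroup N] [Module R N]
    [Module.Finite R N] {x : R} (hxm : x ∈ maximalIdeal R) (hx : IsSMulRegular N x) {d : ℕ}
    {ys : List R} (hlen : ys.length = d + 1) (hmem : ∀ y ∈ ys, y ∈ maximalIdeal R)
    (hreg : IsRegular N ys) :
    ∃ rs : List R, rs.length = d ∧ (∀ r ∈ rs, r ∈ maximalIdeal R) ∧
      IsRegular (QuotSMulTop x N) rs := by
  have hN : Nontrivial N := hreg.nontrivial
  have hNx : Nontrivial (QuotSMulTop x N) := nontrivial_quotSMulTop_of_mem_maximalIdeal N hxm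
  have lt (L : Type v) [AddCommGroup L] [Module R L] [Module.Finite R L] [Nontrivial L] :
      maximalIdeal R • (⊤ : Submodule R L) < ⊤ :=
    (Submodule.top_ne_ideal_smul_of_le_jacobson_annihilator
      (maximalIdeal_le_jacobson _)).symm.lt_top
  -- Rees: a regular sequence of length d + 1 in 𝔪 exists iff Extⁱ(R/𝔪, N) = 0 for i ≤ d. The long
  -- exact sequence of multiplication by x then costs one degree.
  have hiff := (ModuleCat.exists_isRegular_tfae (maximalIdeal R) (d + 1) (ModuleCat.of R N)
    (lt N)).out 3 1
  have hext := hiff.mp ⟨ys, hlen, hmem, hreg⟩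
  refine ((ModuleCat.exists_isRegular_tfae (maximalIdeal R) d
    (ModuleCat.of R (QuotSMulTop x N)) (lt _)).out 1 3).mp fun i hi ↦ ?_
  have h₁ := AddCommGrpCat.isZero_of_iff_subsingleton.mpr (hext i (by omega))
  have h₂ := AddCommGrpCat.isZero_of_iff_subsingleton.mpr (hext (i + 1) (by omega))
  exact AddCommGrpCat.subsingleton_of_isZero <|
    CategoryTheory.ShortComplex.Exact.isZero_of_both_zeros
      ((CategoryTheory.Abelian.Ext.covariant_sequence_exact₃' _
        (IsSMulRegular.smulShortComplex_shortExact (M := ModuleCat.of R N) hx)) i (i + 1) rfl)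
      (h₁.eq_zero_of_src _) (h₂.eq_zero_of_tgt _)

open IsLocalRing Pointwise in
/-- An associated prime of `N` lies, together with a regular element `y` of the maximal ideal,
in an associated prime of `N / yN`. -/
theorem exists_isAssociatedPrime_quotSMulTop {R : Type u} [CommRing R] [IsLocalRing R]
    [IsNoetherianRing R] {N : Type v} [AddCommGroup N] [Module R N] [Module.Finite R N]
    {y : R} (hym : y ∈ maximalIdeal R) (hy : IsSMulRegular N y) {P : Ideal R}
    (hP : IsAssociatedPrime P N) :
    ∃ Q : Ideal R, IsAssociatedPrime Q (QuotSMulTop y N) ∧ P ≤ Q ∧ y ∈ Q := by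
  obtain ⟨hPp, u, hu⟩ := isAssociatedPrime_iff.mp hP
  let U : Submodule R N := Submodule.torsionBySet R N (P : Set R)
  have memU (w : N) : w ∈ U ↔ ∀ a ∈ P, a • w = 0 := by simp [U]
  have huU : u ∈ U := (memU u).mpr fun a ha ↦ by simpa using (hu ▸ ha :)
  have hu0 : u ≠ 0 := by rintro rfl; exact hPp.ne_top (hu.trans (by ext; simp))
  -- If U ⊆ yN, regularity of y gives U = yU, and Nakayama gives U = 0. So some w ∈ U survives in N
  -- / yN, where P and y kill it.
  obtain ⟨w, hwU, hw⟩ : ∃ w ∈ U, w ∉ y • (⊤ : Submodule R N) := by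
    by_contra! h
    have hle : U ≤ Ideal.span {y} • U := by
      intro w hw
      obtain ⟨z, -, rfl⟩ := (Submodule.mem_smul_pointwise_iff_exists _ _ _).mp (h w hw)
      rw [Submodule.ideal_span_singleton_smul]
      refine Submodule.smul_mem_pointwise_smul z y _ ((memU z).mpr fun a ha ↦ ?_)
      have := (memU _).mp hw a ha
      rw [smul_comm] at this
      exact hy.right_eq_zero_of_smul this
    have hbot : U = ⊥ := Submodule.eq_bot_of_le_smul_of_le_jacobson_bot _ U
      (IsNoetherian.noetherian U) hle (by
        rw [jacobson_eq_maximalIdeal _ bot_ne_top, Ideal.span_singleton_le_iff_mem]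
        exact hym)
    exact hu0 (by simpa [hbot] using huU)
  obtain ⟨Q, hQ, hle⟩ := exists_le_isAssociatedPrime_of_isNoetherianRing R
    (Submodule.Quotient.mk (p := y • (⊤ : Submodule R N)) w)
    (by rwa [Ne, Submodule.Quotient.mk_eq_zero])
  refine ⟨Q, hQ, fun a ha ↦ hle ?_, hle ?_⟩
  · rw [Submodule.mem_colon_singleton, ← Submodule.Quotient.mk_smul, (memU w).mp hwU a ha]
    simp
  · rw [Submodule.mem_colon_singleton, ← Submodule.Quotient.mk_smul, Submodule.mem_bot,
      Submodule.Quotient.mk_eq_zero]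
    exact Submodule.smul_mem_pointwise_smul w y _ trivial

open RingTheory.Sequence IsLocalRing in
/-- The length of an `N`-regular sequence is at most `dim R / P` for every associated prime `P`
of `N`. -/
theorem length_le_ringKrullDim_quotient_of_isAssociatedPrime {R : Type u} [CommRing R]
    [IsLocalRing R] [IsNoetherianRing R] {N : Type v} [AddCommGroup N] [Module R N]
    [Module.Finite R N] {ys : List R} (hmem : ∀ y ∈ ys, y ∈ maximalIdeal R)
    (hreg : IsRegular N ys) {P : Ideal R} (hP : IsAssociatedPrime P N) :
    (ys.length : WithBot ℕ∞) ≤ ringKrullDim (R ⧸ P) := by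
  induction ys generalizing N P with
  | nil =>
    have := hP.isPrime
    simpa using ringKrullDim_nonneg_of_nontrivial (R := R ⧸ P)
  | cons y ys ih =>
    rw [isRegular_cons_iff] at hreg
    simp only [List.mem_cons, forall_eq_or_imp] at hmem
    obtain ⟨Q, hQ, hPQ, hyQ⟩ := exists_isAssociatedPrime_quotSMulTop hmem.1 hreg.1 hP
    have hyP : y ∉ P := fun h ↦ by
      have := Set.mem_biUnion (s := associatedPrimes R N) (t := fun p ↦ (p : Set R)) hP h
      rw [biUnion_associatedPrimes_eq_compl_regular] at this
      exact this hreg.1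
    have := hP.isPrime
    have hnzd : Ideal.Quotient.mk P y ∈ nonZeroDivisors (R ⧸ P) := by
      rwa [mem_nonZeroDivisors_iff_ne_zero, Ne, Ideal.Quotient.eq_zero_iff_mem]
    calc ((y :: ys).length : WithBot ℕ∞) = ys.length + 1 := by simp
      _ ≤ ringKrullDim (R ⧸ Q) + 1 := by gcongr; exact ih hmem.2 hreg.2 hQ
      _ ≤ ringKrullDim (R ⧸ P) := ringKrullDim_succ_le_of_surjective (Ideal.Quotient.factor hPQ)
        (Ideal.Quotient.factor_surjective hPQ) hnzd
        (by simpa [Ideal.Quotient.eq_zero_iff_mem] using hyQ)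

open IsLocalRing in
/-- If `𝔪` is the radical of `P + (x₁, …, xₑ)`, then `dim R / P ≤ e`. -/
theorem ringKrullDim_quotient_le_length {R : Type u} [CommRing R] [IsLocalRing R]
    [IsNoetherianRing R] {P : Ideal R} [P.IsPrime] {xs : List R}
    (hxs : maximalIdeal R ≤ (P ⊔ Ideal.ofList xs).radical) (hmem : ∀ x ∈ xs, x ∈ maximalIdeal R) :
    ringKrullDim (R ⧸ P) ≤ xs.length := by
  classical
  let f := Ideal.Quotient.mk P
  have : IsLocalRing (R ⧸ P) := .of_surjective' f Ideal.Quotient.mk_surjective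
  have hloc : IsLocalHom f := .of_surjective f Ideal.Quotient.mk_surjective
  let s : Finset (R ⧸ P) := (xs.map f).toFinset
  have hmin : maximalIdeal (R ⧸ P) ∈ (Ideal.span (s : Set (R ⧸ P))).minimalPrimes := by
    refine ⟨⟨inferInstance, ?_⟩, ?_⟩
    · rw [Ideal.span_le]
      intro z hz
      obtain ⟨x, hx, rfl⟩ : ∃ x ∈ xs, f x = z := by simpa [s] using hz
      exact map_nonunit f x (hmem x hx)
    · rintro q ⟨hq, hsq⟩ -
      intro z hz
      obtain ⟨a, rfl⟩ := Ideal.Quotient.mk_surjective z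
      have hle : P ⊔ Ideal.ofList xs ≤ q.comap f := by
        refine sup_le (fun b hb ↦ ?_) (Ideal.span_le.mpr fun b hb ↦ ?_)
        · simp [f, Ideal.mem_comap, Ideal.Quotient.eq_zero_iff_mem.mpr hb]
        · exact hsq (Ideal.subset_span (by simpa [s] using ⟨b, hb, rfl⟩))
      exact (Ideal.IsPrime.radical_le_iff (hq.comap f)).mpr hle
        (hxs fun ha ↦ hz (ha.map f))
  rw [← maximalIdeal_height_eq_ringKrullDim]
  have h₁ := Ideal.height_le_card_of_mem_minimalPrimes_span_finset hmin
  have h₂ : s.card ≤ xs.length := (List.toFinset_card_le _).trans (by simp)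
  exact_mod_cast h₁.trans (Nat.cast_le.mpr h₂)

open RingTheory.Sequence IsLocalRing Pointwise in
/-- Let `N` have a regular sequence of length `e` and let `J` annihilate `N`. If `x₁, …, xₑ`
generate an `𝔪`-primary ideal modulo `J`, then they form an `N`-regular sequence. -/
theorem isWeaklyRegular_of_maximalIdeal_le_radical {R : Type u} [CommRing R] [IsLocalRing R]
    [IsNoetherianRing R] {N : Type v} [Small.{v} R] [AddCommGroup N] [Module R N]
    [Module.Finite R N] {ys : List R} (hymem : ∀ y ∈ ys, y ∈ maximalIdeal R)
    (hreg : IsRegular N ys) {xs : List R} (hlen : xs.length = ys.length)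
    (hxmem : ∀ x ∈ xs, x ∈ maximalIdeal R) {J : Ideal R} (hJ : J ≤ Module.annihilator R N)
    (hrad : maximalIdeal R ≤ (J ⊔ Ideal.ofList xs).radical) :
    IsWeaklyRegular N xs := by
  induction xs generalizing N J ys with
  | nil => exact .nil R N
  | cons x xs ih =>
    simp only [List.mem_cons, forall_eq_or_imp] at hxmem
    rw [Ideal.ofList_cons, ← sup_assoc] at hrad
    -- A zero divisor x would lie in an associated prime P ⊇ J. Then R/P has dimension at most the
    -- length of the tail, yet at least that of `ys`, which is one more.
    have hx : IsSMulRegular N x := by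
      by_contra hx
      have : x ∈ {r : R | IsSMulRegular N r}ᶜ := hx
      rw [← biUnion_associatedPrimes_eq_compl_regular] at this
      obtain ⟨P, hP, hxP⟩ := Set.mem_iUnion₂.mp this
      have := IsAssociatedPrime.isPrime hP
      have hJP : J ⊔ Ideal.span {x} ≤ P := sup_le
        (hJ.trans (Submodule.annihilator_top (R := R) (M := N) ▸
          IsAssociatedPrime.annihilator_le hP))
        (by rwa [Ideal.span_singleton_le_iff_mem])
      have h₁ := length_le_ringKrullDim_quotient_of_isAssociatedPrime hymem hreg hP
      have h₂ := ringKrullDim_quotient_le_length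
        (hrad.trans (Ideal.radical_mono (sup_le_sup_right hJP _))) hxmem.2
      have h₃ := h₁.trans h₂
      rw [← hlen, List.length_cons] at h₃
      have h₄ : xs.length + 1 ≤ xs.length := by exact_mod_cast h₃
      omega
    obtain ⟨rs, hrs, hrmem, hrreg⟩ := exists_isRegular_quotSMulTop hxmem.1 hx hlen.symm hymem hreg
    refine .cons hx (ih hrmem hrreg hrs.symm hxmem.2 (J := J ⊔ Ideal.span {x}) ?_ hrad)
    refine sup_le (hJ.trans ?_) ?_
    · exact LinearMap.annihilator_le_of_surjective _ (Submodule.mkQ_surjective _)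
    · rw [Ideal.span_singleton_le_iff_mem, Module.mem_annihilator]
      intro z
      obtain ⟨w, rfl⟩ := Submodule.mkQ_surjective _ z
      rw [← map_smul]
      exact (Submodule.Quotient.mk_eq_zero _).mpr (Submodule.smul_mem_pointwise_smul w x _ trivial)

open RingTheory.Sequence Pointwise in
/-- If a sequence `rs` is weakly regular on the target of a surjection `g`, every element of
`ker g` lying in `(rs)F` lies in `(rs) ker g`. -/
theorem ker_inf_ofList_smul_le {R : Type u} [CommRing R] {F N : Type*} [AddCommGroup F]
    [Module R F] [AddCommGroup N] [Module R N] (g : F →ₗ[R] N) (hg : Function.Surjective g)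
    {rs : List R} (h : IsWeaklyRegular N rs) :
    LinearMap.ker g ⊓ Ideal.ofList rs • ⊤ ≤ Ideal.ofList rs • LinearMap.ker g := by
  -- With zero as first term, exactness modulo `rs` says that ker g / (rs) ker g → F / (rs)F is
  -- injective.
  have hex := map_first_exact_on_four_term_right_exact_of_isSMulRegular_last
    (f₁ := (0 : PUnit →ₗ[R] LinearMap.ker g)) (f₂ := (LinearMap.ker g).subtype) (f₃ := g)
    (by intro x; simp [eq_comm (a := x)]) (LinearMap.exact_subtype_ker_map g) hg h
  rintro z ⟨hz, hz'⟩
  obtain ⟨w, hw⟩ := (hex (Submodule.Quotient.mk ⟨z, hz⟩)).mp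
    (by simpa [Submodule.Quotient.mk_eq_zero] using hz')
  obtain ⟨w, rfl⟩ := Submodule.Quotient.mk_surjective _ w
  have hz₂ : (⟨z, hz⟩ : LinearMap.ker g) ∈
      Ideal.ofList rs • (⊤ : Submodule R (LinearMap.ker g)) := by
    rw [← Submodule.Quotient.mk_eq_zero, ← hw]
    simp
  have := Submodule.mem_map_of_mem (f := (LinearMap.ker g).subtype) hz₂
  simpa [Submodule.map_smul''] using this

/-! ### Generating families and their relations. -/

open IsLocalRing in
/-- A finite module over a local ring has a finite generating family all of whose relations have
coefficients in the maximal ideal. -/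
theorem exists_span_eq_top_relations_mem_maximalIdeal (R : Type u) [CommRing R] [IsLocalRing R]
    (M : Type v) [AddCommGroup M] [Module R M] [Module.Finite R M] :
    ∃ (k : ℕ) (g : Fin k → M), Submodule.span R (Set.range g) = ⊤ ∧
      ∀ a : Fin k → R, ∑ i, a i • g i = 0 → ∀ i, a i ∈ maximalIdeal R := by
  let b := Module.finBasis (ResidueField R) (ResidueField R ⊗[R] M)
  have hsurj : Function.Surjective (TensorProduct.mk R (ResidueField R) M 1) :=
    TensorProduct.mk_surjective _ _ _ residue_surjective
  choose g hg using fun i ↦ hsurj (b i)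
  refine ⟨_, g, span_eq_top_of_tmul_eq_basis g b hg, fun a ha ↦ ?_⟩
  have h : ∑ i, residue R (a i) • b i = 0 := by
    have := congrArg (TensorProduct.mk R (ResidueField R) M 1) ha
    simp only [map_sum, map_smul, map_zero, hg] at this
    simpa only [← ResidueField.algebraMap_eq, algebraMap_smul] using this
  intro i
  rw [← residue_eq_zero_iff]
  exact Fintype.linearIndependent_iff.mp b.linearIndependent _ h i

/-- A generating family of a projective module all of whose relations have nilpotent coefficients
is linearly independent. -/
theorem linearIndependent_of_isNilpotent_relations {Q : Type*} [CommRing Q] {P : Type*}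
    [AddCommGroup P] [Module Q P] [Module.Projective Q P] {k : ℕ} {w : Fin k → P}
    (hw : Submodule.span Q (Set.range w) = ⊤)
    (hnil : ∀ a : Fin k → Q, ∑ i, a i • w i = 0 → ∀ i, IsNilpotent (a i)) :
    LinearIndependent Q w := by
  let h : (Fin k → Q) →ₗ[Q] P := Fintype.linearCombination Q w
  have happ (a : Fin k → Q) : h a = ∑ i, a i • w i := Fintype.linearCombination_apply Q w a
  have hsurj : LinearMap.range h = ⊤ := by rw [← hw]; exact Fintype.range_linearCombination Q w
  obtain ⟨s, hs⟩ := h.exists_rightInverse_of_surjective hsurj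
  -- E projects onto ker h. For a ∈ ker h, a = ∑ aᵢ E(eᵢ) with aᵢ nilpotent, so ker h = nil(Q) · ker
  -- h.
  let E : (Fin k → Q) →ₗ[Q] (Fin k → Q) := LinearMap.id - s ∘ₗ h
  have hE (a : Fin k → Q) : E a ∈ LinearMap.ker h := by
    have := LinearMap.congr_fun hs (h a)
    simp only [LinearMap.comp_apply, LinearMap.id_apply] at this
    simp [E, LinearMap.mem_ker, this]
  have hEker {a : Fin k → Q} (ha : a ∈ LinearMap.ker h) : E a = a := by
    simp [E, LinearMap.mem_ker.mp ha]
  have hrange : LinearMap.range E = LinearMap.ker h :=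
    le_antisymm (by rintro _ ⟨a, rfl⟩; exact hE a) fun a ha ↦ ⟨a, hEker ha⟩
  have hbot : LinearMap.ker h = ⊥ := by
    refine Submodule.eq_bot_of_le_smul_of_le_jacobson_bot (nilradical Q) _ ?_ (fun a ha ↦ ?_) ?_
    · rw [← hrange, LinearMap.range_eq_map]
      exact Module.Finite.fg_top.map E
    · rw [← hEker ha, pi_eq_sum_univ' a, map_sum]
      refine Submodule.sum_mem _ fun i _ ↦ ?_
      rw [map_smul]
      exact Submodule.smul_mem_smul (mem_nilradical.mpr (hnil a (happ a ▸ ha) i)) (hE _)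
    · exact Ideal.radical_le_jacobson
  exact Fintype.linearIndependent_iff.mpr fun a ha ↦
    congrFun ((LinearMap.ker_eq_bot'.mp hbot) a ((happ a).trans ha))

/-- A module with a rank is free as soon as it has a finite generating family all of whose
relations have nilpotent coefficients. -/
theorem ModuleHasRank.free_of_isNilpotent_relations {R : Type u} [CommRing R] {M : Type v}
    [AddCommGroup M] [Module R M] (hM : ModuleHasRank R M) {k : ℕ} {g : Fin k → M}
    (hg : Submodule.span R (Set.range g) = ⊤)
    (hnil : ∀ a : Fin k → R, ∑ i, a i • g i = 0 → ∀ i, IsNilpotent (a i)) :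
    Module.Free R M := by
  obtain ⟨r, ⟨e⟩⟩ := hM
  let S := nonZeroDivisors R
  have : Module.Projective (Localization S) (LocalizedModule S M) := .of_equiv e.symm
  let ℓ := LocalizedModule.mkLinearMap S M
  have hspan : Submodule.span (Localization S) (Set.range (ℓ ∘ g)) = ⊤ := by
    rw [Set.range_comp]
    exact span_eq_top_of_isLocalizedModule (Localization S) S ℓ hg
  have hind : LinearIndependent (Localization S) (ℓ ∘ g) := by
    refine linearIndependent_of_isNilpotent_relations hspan fun q hq i ↦ ?_
    -- s clears denominators and t makes the relation hold in M itself; both become units, so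
    -- nilpotence of t aᵢ passes to qᵢ.
    obtain ⟨s, hs⟩ := IsLocalization.exist_integer_multiples_of_finite S q
    choose a ha using hs
    have hsum : ℓ (∑ i, a i • g i) = 0 := by
      have : (s : R) • ∑ i, q i • (ℓ ∘ g) i = 0 := by rw [hq, smul_zero]
      rw [← this, Finset.smul_sum, map_sum]
      refine Finset.sum_congr rfl fun j _ ↦ ?_
      rw [map_smul, ← smul_assoc, ← ha j, algebraMap_smul, Function.comp_apply]
    obtain ⟨t, ht⟩ := (IsLocalizedModule.eq_zero_iff S ℓ).mp hsum
    have hta : IsNilpotent ((t : R) * a i) := by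
      refine hnil (fun i ↦ t * a i) ?_ i
      simp only [mul_smul, ← Finset.smul_sum]
      exact ht
    have := hta.map (algebraMap R (Localization S))
    rw [map_mul, ha i, Algebra.smul_def, ← mul_assoc, ← map_mul] at this
    obtain ⟨m, hm⟩ := this
    refine ⟨m, ?_⟩
    rw [mul_pow] at hm
    exact ((IsLocalization.map_units (Localization S) (t * s)).pow m).mul_right_eq_zero.mp
      (by simpa using hm)
  have hli : LinearIndependent R g := by
    refine Fintype.linearIndependent_iff.mpr fun a ha i ↦ ?_
    have := Fintype.linearIndependent_iff.mp hind (fun i ↦ algebraMap R (Localization S) (a i))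
      (by simpa using congrArg ℓ ha) i
    exact (IsLocalization.injective (Localization S) le_rfl) (this.trans (map_zero _).symm)
  exact .of_basis (.mk hli hg.ge)

/-! ### Generators and relations of F^n(M). -/

section Frobenius

variable {R : Type u} [CommRing R] (p : ℕ) [Fact p.Prime] [CharP R p] (n : ℕ)
  {M : Type v} [AddCommGroup M] [Module R M]

/-- The element `1 ⊗ m` of `F^n(M)`. -/
def FrobFunctor.mk (m : M) : FrobFunctor R p n M := (1 : FrobTwist R p n) ⊗ₜ[R] m

theorem FrobFunctor.smul_mk (a : R) (m : M) :
    a • FrobFunctor.mk p n m =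
      (show FrobFunctor R p n M from FrobTwist.of R p n a ⊗ₜ[R] m) := by
  have := FrobFunctor.smul_tmul R p n M a 1 m
  rwa [mul_one] at this

theorem FrobFunctor.pow_smul_mk (a : R) (m : M) :
    (a ^ p ^ n) • FrobFunctor.mk p n m = FrobFunctor.mk (R := R) p n (a • m) := by
  rw [FrobFunctor.smul_mk, ← FrobTwist.algebraMap_apply, Algebra.algebraMap_eq_smul_one]
  exact TensorProduct.smul_tmul a 1 m

theorem FrobFunctor.mk_sum {ι : Type*} (s : Finset ι) (f : ι → M) :
    FrobFunctor.mk (R := R) p n (∑ i ∈ s, f i) = ∑ i ∈ s, FrobFunctor.mk p n (f i) :=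
  TensorProduct.tmul_sum _ _ _

theorem FrobFunctor.mk_zero : FrobFunctor.mk (R := R) p n (0 : M) = 0 :=
  TensorProduct.tmul_zero _ _

theorem FrobFunctor.span_range_mk {ι : Type*} {g : ι → M}
    (hg : Submodule.span R (Set.range g) = ⊤) :
    Submodule.span R (Set.range fun i ↦ FrobFunctor.mk (R := R) p n (g i)) = ⊤ := by
  set T := Submodule.span R (Set.range fun i ↦ FrobFunctor.mk (R := R) p n (g i))
  have hmk (m : M) : FrobFunctor.mk p n m ∈ T := by
    have hm : m ∈ Submodule.span R (Set.range g) := hg ▸ trivial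
    induction hm using Submodule.span_induction with
    | mem x hx => obtain ⟨i, rfl⟩ := hx; exact Submodule.subset_span ⟨i, rfl⟩
    | zero => rw [FrobFunctor.mk_zero]; exact T.zero_mem
    | add x y _ _ hx hy =>
      have : FrobFunctor.mk (R := R) p n (x + y) = FrobFunctor.mk p n x + FrobFunctor.mk p n y :=
        TensorProduct.tmul_add _ _ _
      rw [this]; exact T.add_mem hx hy
    | smul a x _ hx => rw [← FrobFunctor.pow_smul_mk]; exact T.smul_mem _ hx
  refine eq_top_iff.mpr fun z _ ↦ ?_
  induction z using TensorProduct.induction_on with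
  | zero => exact T.zero_mem
  | tmul a m =>
    have := T.smul_mem ((FrobTwist.of R p n).symm a) (hmk m)
    rwa [FrobFunctor.smul_mk, RingEquiv.apply_symm_apply] at this
  | add x y hx hy => exact T.add_mem (hx trivial) (hy trivial)

/-- Every relation among the generators `1 ⊗ gᵢ` of `F^n(M)` is a combination of relations
obtained by raising the coefficients of relations among the `gᵢ` to the `p^n`-th power. -/
theorem FrobFunctor.exists_relations {ι : Type*} [Fintype ι] {g : ι → M}
    (hg : Submodule.span R (Set.range g) = ⊤) {b : ι → R}
    (hb : ∑ i, b i • FrobFunctor.mk (R := R) p n (g i) = 0) :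
    ∃ (k : ℕ) (a : ι → Fin k → R) (y : Fin k → R),
      (∀ i, b i = ∑ j, a i j ^ p ^ n * y j) ∧ ∀ j, ∑ i, a i j • g i = 0 := by
  have hb' : ∑ i, g i ⊗ₜ[R] FrobTwist.of R p n (b i) = 0 := by
    simp only [FrobFunctor.smul_mk] at hb
    have hb₀ : ∑ i, FrobTwist.of R p n (b i) ⊗ₜ[R] g i = 0 := hb
    simpa using congrArg (TensorProduct.comm R (FrobTwist R p n) M) hb₀
  -- Equational criterion for the vanishing of a tensor, which needs the generating family on the
  -- left.
  obtain ⟨k, a, y, h₁, h₂⟩ := TensorProduct.vanishesTrivially_of_sum_tmul_eq_zero R hg hb'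
  refine ⟨k, a, fun j ↦ (FrobTwist.of R p n).symm (y j), fun i ↦ ?_, h₂⟩
  apply (FrobTwist.of R p n).injective
  refine (h₁ i).trans ?_
  rw [map_sum]
  refine Finset.sum_congr rfl fun j _ ↦ ?_
  rw [map_mul, ← FrobTwist.algebraMap_apply, RingEquiv.apply_symm_apply, Algebra.smul_def]

end Frobenius

/-! ### From the numerical invariants to the theorem. -/

theorem Ideal.frobPower_anti {R : Type u} [CommRing R] {I : Ideal R} {p : ℕ} (hp : p ≠ 0)
    {s t : ℕ} (hst : s ≤ t) : I.frobPower p t ≤ I.frobPower p s := by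
  refine Ideal.span_le.mpr ?_
  rintro _ ⟨a, ha, rfl⟩
  refine Ideal.subset_span ⟨a ^ p ^ (t - s), Ideal.pow_mem_of_mem I ha _ (by positivity), ?_⟩
  simp only [← pow_mul, ← pow_add, Nat.sub_add_cancel hst]

/-- If `κ(R) ≤ n`, then `𝔪^{[p^n]}` lies in the ideal of some system of parameters. -/
theorem exists_isSystemOfParameters_of_frobKappa_le {R : Type u} [CommRing R] [IsLocalRing R]
    {p n : ℕ} (hp : p ≠ 0) (hn : frobKappa R p ≤ n) :
    ∃ xs : List R, IsSystemOfParameters R xs ∧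
      (IsLocalRing.maximalIdeal R).frobPower p n ≤ Ideal.ofList xs := by
  have hlt : frobKappa R p < (n + 1 : ℕ) := hn.trans_lt (by exact_mod_cast n.lt_succ_self)
  simp only [frobKappa, iInf_lt_iff, Nat.cast_lt] at hlt
  obtain ⟨t, ⟨xs, hxs, hle⟩, ht⟩ := hlt
  exact ⟨xs, hxs, (Ideal.frobPower_anti hp (Nat.lt_succ_iff.mp ht)).trans hle⟩

/-- A positive depth is attained by a regular sequence. -/
theorem exists_isRegular_length_eq_localDepth {R : Type u} [CommRing R] [IsLocalRing R]
    {N : Type v} [AddCommGroup N] [Module R N] {d : ℕ} (hd : 0 < d) (h : localDepth R N = d) :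
    ∃ ys : List R, ys.length = d ∧ (∀ y ∈ ys, y ∈ IsLocalRing.maximalIdeal R) ∧
      RingTheory.Sequence.IsRegular N ys := by
  -- For d = 0 the supremum may be over an empty family, as for N = 0.
  have hlt : ((d - 1 : ℕ) : ℕ∞) < localDepth R N := by
    rw [h]; exact_mod_cast Nat.sub_lt hd one_pos
  simp only [localDepth, lt_iSup_iff, Nat.cast_lt] at hlt
  obtain ⟨ys, hys, hlen⟩ := hlt
  have hle : (ys.length : ℕ∞) ≤ localDepth R N :=
    le_iSup₂ (f := fun (xs : List R) (_ : (∀ x ∈ xs, x ∈ IsLocalRing.maximalIdeal R) ∧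
      RingTheory.Sequence.IsRegular N xs) ↦ (xs.length : ℕ∞)) ys hys
  rw [h, Nat.cast_le] at hle
  exact ⟨ys, by omega, hys⟩

/-- Over a Noetherian local ring of positive dimension, every system of parameters is a (weakly)
regular sequence on a maximal Cohen-Macaulay module. -/
theorem IsMaximalCohenMacaulay.isWeaklyRegular {R : Type u} [CommRing R] [IsLocalRing R]
    [IsNoetherianRing R] (hdim : 0 < ringKrullDim R) {N : Type v} [Small.{v} R] [AddCommGroup N]
    [Module R N] (hN : IsMaximalCohenMacaulay R N) {xs : List R}
    (hxs : IsSystemOfParameters R xs) : RingTheory.Sequence.IsWeaklyRegular N xs := by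
  have := hN.finite
  have hdepth : localDepth R N = xs.length := by
    have := hN.depth_eq.trans (hN.dim_eq.trans hxs.length_eq.symm)
    exact_mod_cast this
  have hpos : 0 < xs.length := by
    have := hxs.length_eq ▸ hdim
    exact_mod_cast this
  obtain ⟨ys, hlen, hmem, hreg⟩ := exists_isRegular_length_eq_localDepth hpos hdepth
  refine isWeaklyRegular_of_maximalIdeal_le_radical (J := ⊥) hmem hreg hlen.symm (fun x hx ↦ ?_)
    bot_le (by rw [bot_sup_eq, hxs.radical_eq])
  rw [← hxs.radical_eq]
  exact Ideal.le_radical (Ideal.subset_span hx)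

theorem theorem2p4 {R : Type*} [CommRing R] [IsLocalRing R] (p : ℕ) [Fact p.Prime] [CharP R p]
    (hR : IsCohenMacaulayLocalRing R) (hdim : 0 < ringKrullDim R)
    {M : Type*} [AddCommGroup M] [Module R M] [Module.Finite R M] (hM : ModuleHasRank R M)
    (n : ℕ) (hn : frobKappa R p ≤ (n : ℕ∞))
    (hF : IsMaximalCohenMacaulay R (FrobFunctor R p n M)) :
    Module.Free R M := by
  have := hR.noetherian
  obtain ⟨xs, hxs, hle⟩ := exists_isSystemOfParameters_of_frobKappa_le
    (Fact.out (p := p.Prime)).ne_zero hn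
  obtain ⟨k, g, hg, hrel⟩ := exists_span_eq_top_relations_mem_maximalIdeal R M
  let h : (Fin k → R) →ₗ[R] FrobFunctor R p n M :=
    Fintype.linearCombination R fun i ↦ FrobFunctor.mk p n (g i)
  have happ (b : Fin k → R) : h b = ∑ i, b i • FrobFunctor.mk p n (g i) :=
    Fintype.linearCombination_apply R _ b
  have hsurj : Function.Surjective h := LinearMap.range_eq_top.mp <|
    (Fintype.range_linearCombination R _).trans (FrobFunctor.span_range_mk p n hg)
  -- Minimality of g puts every `a i j` in 𝔪, hence its p^n-th power in (𝐱).
  have hker : LinearMap.ker h ≤ Ideal.ofList xs • ⊤ := by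
    intro b hb
    obtain ⟨l, a, y, hby, hag⟩ := FrobFunctor.exists_relations p n hg ((happ b).symm.trans hb)
    rw [pi_eq_sum_univ' b]
    refine Submodule.sum_mem _ fun i _ ↦ Submodule.smul_mem_smul ?_ trivial
    rw [hby]
    exact Ideal.sum_mem _ fun j _ ↦ Ideal.mul_mem_right _ _
      (hle (Ideal.subset_span ⟨a i j, hrel _ (hag j) i, rfl⟩))
  have hbot : LinearMap.ker h = ⊥ := by
    refine Submodule.eq_bot_of_le_smul_of_le_jacobson_bot (Ideal.ofList xs) _
      (IsNoetherian.noetherian _) ?_ ?_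
    · exact (le_inf le_rfl hker).trans
        (ker_inf_ofList_smul_le h hsurj (hF.isWeaklyRegular hdim hxs))
    · rw [IsLocalRing.jacobson_eq_maximalIdeal _ bot_ne_top, ← hxs.radical_eq]
      exact Ideal.le_radical
  refine hM.free_of_isNilpotent_relations hg fun a ha i ↦ ⟨p ^ n, ?_⟩
  refine congrFun (LinearMap.ker_eq_bot'.mp hbot (fun i ↦ a i ^ p ^ n) ?_) i
  simp only [happ, FrobFunctor.pow_smul_mk, ← FrobFunctor.mk_sum, ha, FrobFunctor.mk_zero]
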